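/- Let $2\le m\le n$ be integers, and let $\mathscr G(n,m)$ be the set of $m$-dimensional linear subspaces of $\mathbb R^n$ with the angle metric $\sphericalangle(F,G)=\|\Pi_F-\Pi_G\|$, the operator norm of the difference of the orthogonal projections. For $x\ne y$ in $\mathbb R^n$ let $\mathcal R_{xy}(z)=z-\frac{2}{|x-y|^2}\langle z,x-y\rangle (x-y)$. Write $B_r(x)$ for the open ball of radius $r$ around $x$ and $\mathscr H^m$ for the $m$-dimensional Hausdorff measure. For a set $S\subset\mathbb R^n$, a map $H\colon S\to\mathscr G(n,m)$ and $\tau>-1$ put $$E^\tau(S,H)=\int_S\int_S\frac{\sphericalangle\big(\mathcal R_{xy}(H(x)),H(y)\big)^{(1+\tau)m}}{|x-y|^{2m}}\,d\mathscr H^m(x)\,d\mathscr H^m(y).$$ For each $i\in\mathbb N$ let $p_i\in\mathbb R^n$, $F_i\in\mathscr G(n,m)$, and let $u_i\colon F_i\to F_i^\perp$ be Lipschitz with $u_i(0)=0$ and $\operatorname{Lip}u_i\le\beta$, where $\beta<1/6400$ does not depend on $i$. Put $\Gamma_i=p_i+\operatorname{graph}u_i=\{p_i+\xi+u_i(\xi):\xi\in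 F_i\}$ and $$\Sigma=\overline{\bigcup_{i\in\mathbb N}\Gamma_i}.$$ Let $H\colon\Sigma\to\mathscr G(n,m)$ be such that $H(q)$ is the tangent plane $T_q\Gamma_i=\{v+Du_i(\xi)v:v\in F_i\}$ whenever $i$ is the smallest index with $q\in\Gamma_i$, $q=p_i+\xi+u_i(\xi)$, and $u_i$ is differentiable at $\xi$; at all other points of $\Sigma$ the plane $H(q)$ is arbitrary. Suppose that $\Sigma$ has locally finite energy $E^\tau$ for some $\tau>-1$, that is, $E^\tau(\Sigma\cap B_N(0),H)<\infty$ for all $N\in\mathbb N$. Then for every compact subset $K\subset\Sigma$ there exists a radius $\rho_3=\rho_3(K)>0$ such that for every $q\in K$ there is an index $i=i(q)\in\mathbb N$ with $$\Sigma\cap B_{\rho_3/5}(q)=\Gamma_i\cap B_{\rho_3/5}(q).$$ -/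

import Mathlib

open MeasureTheory Set
open scoped NNReal ENNReal

noncomputable section

/-- The Grassmannian `𝒢(n,m)` of `m`-dimensional linear subspaces of `ℝⁿ`. -/
abbrev Grass (n m : ℕ) : Type :=
  {F : Submodule ℝ (EuclideanSpace ℝ (Fin n)) // Module.finrank ℝ F = m}

/-- The angle metric `∠(F, G) = ‖Π_F - Π_G‖` (operator norm of the difference of the orthogonal
projections). -/
def angleMetric {n : ℕ} (F G : Submodule ℝ (EuclideanSpace ℝ (Fin n))) : ℝ :=
  ‖F.starProjection - G.starProjection‖

/-- The reflection `R_{xy}(z) = z - 2 |x-y|⁻² ⟪z, x-y⟫ (x-y)` at the subspace `(x-y)^⊥`. -/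
def reflXY {n : ℕ} (x y : EuclideanSpace ℝ (Fin n)) :
    EuclideanSpace ℝ (Fin n) ≃ₗᵢ[ℝ] EuclideanSpace ℝ (Fin n) :=
  (Submodule.span ℝ {x - y})ᗮ.reflection

/-- The energy density `∠(R_{xy}(H(x)), H(y))^{(1+τ)m} / |x-y|^{2m}`.  (It is `0` for `x = y`;
the diagonal is a null set.) -/
def moebiusDensity {n m : ℕ} (τ : ℝ) (H : EuclideanSpace ℝ (Fin n) → Grass n m)
    (x y : EuclideanSpace ℝ (Fin n)) : ℝ :=
  angleMetric ((H x).1.map (reflXY x y).toLinearMap) (H y).1 ^ ((1 + τ) * (m : ℝ)) /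
    ‖x - y‖ ^ (2 * m)

/-- The Möbius energy `E^τ(S, H)` of a set `S ⊆ ℝⁿ` with mock tangent planes `H`, as an iterated
integral with respect to the `m`-dimensional Hausdorff measure. Only the values of `H` on `S`
matter. -/
def moebiusEnergy {n m : ℕ} (τ : ℝ) (S : Set (EuclideanSpace ℝ (Fin n)))
    (H : EuclideanSpace ℝ (Fin n) → Grass n m) : ℝ≥0∞ :=
  ∫⁻ y in S, ∫⁻ x in S, ENNReal.ofReal (moebiusDensity τ H x y)
    ∂(Measure.euclideanHausdorffMeasure m) ∂(Measure.euclideanHausdorffMeasure m)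

/-- `S` has locally finite energy `E^τ`: `E^τ(S ∩ B_N(0)) < ∞` for all `N ∈ ℕ`. -/
def LocallyFiniteEnergy {n m : ℕ} (τ : ℝ) (S : Set (EuclideanSpace ℝ (Fin n)))
    (H : EuclideanSpace ℝ (Fin n) → Grass n m) : Prop :=
  ∀ N : ℕ, moebiusEnergy τ (S ∩ Metric.ball 0 N) H < ∞

/-- The point `p + ξ + u(ξ)` of the translated graph `p + graph u` of `u : F → F^⊥`. -/
def graphPoint {n : ℕ} {F : Submodule ℝ (EuclideanSpace ℝ (Fin n))}
    (p : EuclideanSpace ℝ (Fin n)) (u : F → Fᗮ) (ξ : F) : EuclideanSpace ℝ (Fin n) :=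
  p + ((ξ : EuclideanSpace ℝ (Fin n)) + (u ξ : EuclideanSpace ℝ (Fin n)))

/-- The translated graph `p + graph u = {p + ξ + u(ξ) : ξ ∈ F}`. -/
def graphSet {n : ℕ} {F : Submodule ℝ (EuclideanSpace ℝ (Fin n))}
    (p : EuclideanSpace ℝ (Fin n)) (u : F → Fᗮ) : Set (EuclideanSpace ℝ (Fin n)) :=
  Set.range (graphPoint p u)

/-- The linear map `v ↦ v + L v` from `F` to `ℝⁿ`, for a linear map `L : F → F^⊥`. -/
def graphMap {n : ℕ} {F : Submodule ℝ (EuclideanSpace ℝ (Fin n))} (L : F →L[ℝ] Fᗮ) :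
    F →ₗ[ℝ] EuclideanSpace ℝ (Fin n) :=
  F.subtype + Fᗮ.subtype ∘ₗ L.toLinearMap

theorem graphMap_injective {n : ℕ} {F : Submodule ℝ (EuclideanSpace ℝ (Fin n))}
    (L : F →L[ℝ] Fᗮ) : Function.Injective (graphMap L) := by
  rw [← LinearMap.ker_eq_bot, LinearMap.ker_eq_bot']
  intro v hv
  have h1 : (v : EuclideanSpace ℝ (Fin n)) + (L v : EuclideanSpace ℝ (Fin n)) = 0 := hv
  have h2 : inner ℝ (v : EuclideanSpace ℝ (Fin n)) (L v : EuclideanSpace ℝ (Fin n)) = 0 :=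
    (Submodule.mem_orthogonal F _).1 (L v).2 v v.2
  have h3 := congrArg (fun w => inner ℝ (v : EuclideanSpace ℝ (Fin n)) w) h1
  simp only [inner_add_right, h2, add_zero, inner_zero_right] at h3
  exact Subtype.ext (inner_self_eq_zero.1 h3)

/-- The tangent plane `{v + Du(ξ) v : v ∈ F}` of the graph of `u : F → F^⊥` at the graph point over
`ξ` (meaningful where `u` is differentiable at `ξ`). -/
def tangentPlane {n m : ℕ} (F : Grass n m) (u : F.1 → F.1ᗮ) (ξ : F.1) : Grass n m :=
  ⟨LinearMap.range (graphMap (fderiv ℝ u ξ)), by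
    rw [LinearMap.finrank_range_of_inj (graphMap_injective _)]
    exact F.2⟩

/-- `H` is a field of mock tangent planes for the family of graphs `Γ_i = p_i + graph u_i`: if `i`
is the smallest index with `q ∈ Γ_i` and `u_i` is differentiable at the point `ξ` below `q`, then
`H(q)` is the tangent plane of `Γ_i` at `q`. At all other points, `H` is arbitrary. -/
def IsMockTangent {n m : ℕ} (p : ℕ → EuclideanSpace ℝ (Fin n)) (F : ℕ → Grass n m)
    (u : ∀ i, (F i).1 → (F i).1ᗮ) (H : EuclideanSpace ℝ (Fin n) → Grass n m) : Prop :=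
  ∀ (i : ℕ) (ξ : (F i).1), (∀ j < i, graphPoint (p i) (u i) ξ ∉ graphSet (p j) (u j)) →
    DifferentiableAt ℝ (u i) ξ → H (graphPoint (p i) (u i) ξ) = tangentPlane (F i) (u i) ξ

end

/-!
Finite energy prevents different graphs of the family from coming arbitrarily close to each other in
a bounded region; this yields the local description of `S` as a single graph.

Let `Γ = p + graph u`, let `F` be its base plane, and let `z` have *vertical deviation* `h > 0` from
`Γ` (`verticalDev`). For `y` near `z`, compare two regions of `Γ` of size comparable to `h`: one
around the point `a` below `z`, and one around the point of `Γ` over a base point at distance `h`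
from that of `a`. The reflections at the directions from `y` to these regions map `F` nearly to
itself in the first case, and to a plane nearly orthogonal to some unit vector of `F` in the second
case. So no plane `T` is close to both reflected tangent planes (`quarter_le_angleMetric_or`). In
particular the plane `H y` need not be known: whatever it is, one of the two regions contributes at
least a constant times `h⁻ᵐ` to the inner integral at `y` (`le_lintegral_moebiusDensity`), and
integrating over the `y` near `z` gives a contribution to the energy which is bounded below
independently of the scale `h`. Different scales live on disjoint shells `h / 2 ≤ |x - y| < 3 h`, so
arbitrarily small positive deviations in a bounded region would make the energy infinite
(`exists_gap_verticalDev`).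

This argument needs to know `H` only on `Γ`. If `Γ_j` is disjoint from all graphs of smaller index,
then `H` is its tangent plane almost everywhere on `Γ_j`, by Rademacher's theorem. By connectedness,
the gap in the vertical deviation forces each graph meeting such a `Γ_j` to be contained in it
(`graphSet_subset_of_mem_inter`), and a strong induction on the index shows that every graph is
contained in such a `Γ_j` (`exists_graphSet_subset_disjoint`). So only these `Γ_j` matter, and the
part of `S` in a ball whose radius is small compared with the gap lies on one of them.
-/

/-! ### Angles between reflected planes -/

theorem reflXY_apply {n : ℕ} (x y z : EuclideanSpace ℝ (Fin n)) :
    reflXY x y z = z - (2 * (inner ℝ (x - y) z / ‖x - y‖ ^ 2)) • (x - y) := by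
  rw [reflXY, Submodule.reflection_orthogonal_apply, Submodule.reflection_singleton_apply]
  simp [mul_smul, two_smul]

/-- A reflection moves a vector only as much as this vector fails to lie in the mirror. -/
theorem norm_reflXY_sub_self_mul_le {n : ℕ} (x y z : EuclideanSpace ℝ (Fin n)) :
    ‖reflXY x y z - z‖ * ‖x - y‖ ≤ 2 * |inner ℝ (x - y) z| := by
  rw [reflXY_apply, sub_sub_cancel_left, norm_neg, norm_smul]
  rcases eq_or_ne (x - y) 0 with h | h
  · simp [h]
  · have h' : ‖x - y‖ ≠ 0 := norm_ne_zero_iff.2 h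
    rw [Real.norm_eq_abs, abs_mul, abs_div, abs_of_nonneg (by positivity : 0 ≤ ‖x - y‖ ^ 2),
      abs_two]
    apply le_of_eq
    field_simp

theorem starProjection_map_reflXY {n : ℕ} (x y v : EuclideanSpace ℝ (Fin n))
    (G : Submodule ℝ (EuclideanSpace ℝ (Fin n))) :
    (G.map (reflXY x y).toLinearMap).starProjection v =
      reflXY x y (G.starProjection (reflXY x y v)) := by
  have h := Submodule.starProjection_map_apply (reflXY x y) G v
  rw [show (reflXY x y).symm = reflXY x y from Submodule.reflection_symm] at h
  exact h

theorem norm_starProjection_sub_le {n : ℕ} (G T : Submodule ℝ (EuclideanSpace ℝ (Fin n)))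
    (v : EuclideanSpace ℝ (Fin n)) :
    ‖G.starProjection v - T.starProjection v‖ ≤ angleMetric G T * ‖v‖ :=
  (G.starProjection - T.starProjection).le_opNorm v

theorem inner_coe_orthogonal_eq_zero {n : ℕ} {F : Submodule ℝ (EuclideanSpace ℝ (Fin n))} (v : F)
    (w : Fᗮ) : inner ℝ (v : EuclideanSpace ℝ (Fin n)) (w : EuclideanSpace ℝ (Fin n)) = 0 :=
  (Submodule.mem_orthogonal F _).1 w.2 v v.2

theorem norm_le_norm_graphMap {n : ℕ} {F : Submodule ℝ (EuclideanSpace ℝ (Fin n))}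
    (L : F →L[ℝ] Fᗮ) (v : F) : ‖v‖ ≤ ‖graphMap L v‖ := by
  have h : ‖graphMap L v‖ ^ 2 = ‖v‖ ^ 2 + ‖L v‖ ^ 2 := by
    have := norm_add_sq_eq_norm_sq_add_norm_sq_of_inner_eq_zero _ _
      (inner_coe_orthogonal_eq_zero v (L v))
    simpa [sq, graphMap] using this
  nlinarith [norm_nonneg v, norm_nonneg (graphMap L v), sq_nonneg ‖L v‖]

/-- A vector of `F` is nearly fixed by the projection to the graph of a small linear map. -/
theorem norm_starProjection_range_graphMap_sub_le {n : ℕ}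
    {F : Submodule ℝ (EuclideanSpace ℝ (Fin n))} (L : F →L[ℝ] Fᗮ) (v : F) :
    ‖(LinearMap.range (graphMap L)).starProjection v - v‖ ≤ ‖L‖ * ‖v‖ := by
  set G := LinearMap.range (graphMap L)
  have h1 : G.starProjection (graphMap L v) = graphMap L v :=
    Submodule.starProjection_eq_self_iff.2 ⟨v, rfl⟩
  have h2 : (v : EuclideanSpace ℝ (Fin n)) = graphMap L v - (L v : EuclideanSpace ℝ (Fin n)) := by
    simp [graphMap]
  have h3 : G.starProjection (v : EuclideanSpace ℝ (Fin n)) - v =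
      Gᗮ.starProjection (L v : EuclideanSpace ℝ (Fin n)) := by
    rw [Submodule.starProjection_orthogonal_val, h2, map_sub, h1]
    abel
  rw [h3]
  exact (Submodule.norm_starProjection_apply_le _ _).trans (by simpa using L.le_opNorm v)

/-- A vector of `Fᗮ` is nearly annihilated by the projection to the graph of a small linear map. -/
theorem norm_starProjection_range_graphMap_le {n : ℕ}
    {F : Submodule ℝ (EuclideanSpace ℝ (Fin n))} (L : F →L[ℝ] Fᗮ) (b : Fᗮ) :
    ‖(LinearMap.range (graphMap L)).starProjection b‖ ≤ ‖L‖ * ‖b‖ := by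
  set G := LinearMap.range (graphMap L)
  obtain ⟨v, hv⟩ : G.starProjection (b : EuclideanSpace ℝ (Fin n)) ∈ G :=
    Submodule.starProjection_apply_mem _ _
  have h1 : inner ℝ (b : EuclideanSpace ℝ (Fin n)) (graphMap L v) = inner ℝ b (L v) := by
    have : inner ℝ (b : EuclideanSpace ℝ (Fin n)) (v : EuclideanSpace ℝ (Fin n)) = 0 := by
      rw [real_inner_comm]; exact inner_coe_orthogonal_eq_zero v b
    simp [graphMap, inner_add_right, this]
  have h2 : ‖graphMap L v‖ ^ 2 = inner ℝ (b : EuclideanSpace ℝ (Fin n)) (graphMap L v) := by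
    rw [← real_inner_self_eq_norm_sq]
    nth_rw 1 [hv]
    rw [Submodule.inner_starProjection_left_eq_right,
      Submodule.starProjection_eq_self_iff.2 (LinearMap.mem_range_self _ v)]
  have h3 : ‖graphMap L v‖ ^ 2 ≤ ‖L‖ * ‖b‖ * ‖graphMap L v‖ := by
    rw [h2, h1]
    calc _ ≤ ‖b‖ * ‖L v‖ := real_inner_le_norm _ _
      _ ≤ ‖b‖ * (‖L‖ * ‖graphMap L v‖) := by
        gcongr
        exact (L.le_opNorm v).trans (by gcongr; exact norm_le_norm_graphMap L v)
      _ = _ := by ring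
  rw [← hv]
  rcases (norm_nonneg (graphMap L v)).eq_or_lt with h | h
  · rw [← h]; positivity
  · nlinarith

/-- If, up to small errors, `y - x` is the vector `v` orthogonal to `F` and `y' - x` is `v - w` with
`w` in `F` of the same length `h`, then the reflected planes `R_{yx}(G)` and `R_{y'x}(G')`, for `G`
and `G'` close to `F`, are far apart, since one nearly contains the vector `w` and the other is
nearly orthogonal to it. Hence no plane `T` is close to both of them. -/
theorem quarter_le_angleMetric_or {n : ℕ} {F G G' T : Submodule ℝ (EuclideanSpace ℝ (Fin n))}
    {x y y' : EuclideanSpace ℝ (Fin n)} {h : ℝ} (hh : 0 < h) (w : F) (v : Fᗮ)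
    (hw : ‖w‖ = h) (hv : ‖v‖ = h)
    (hy : ‖(y - x) - v‖ ≤ h / 100) (hy' : ‖(y' - x) - (v - w)‖ ≤ h / 100)
    (hG : ‖G.starProjection w - w‖ ≤ h / 100) (hG' : ‖G'.starProjection v‖ ≤ h / 100) :
    1 / 4 ≤ angleMetric (G.map (reflXY y x).toLinearMap) T ∨
      1 / 4 ≤ angleMetric (G'.map (reflXY y' x).toLinearMap) T := by
  by_contra! hcon
  obtain ⟨h1, h2⟩ := hcon
  have hwn : ‖(w : EuclideanSpace ℝ (Fin n))‖ = h := hw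
  have hvn : ‖(v : EuclideanSpace ℝ (Fin n))‖ = h := hv
  have hvw : inner ℝ (v : EuclideanSpace ℝ (Fin n)) (w : EuclideanSpace ℝ (Fin n)) = 0 := by
    rw [real_inner_comm]; exact inner_coe_orthogonal_eq_zero w v
  have hwv := inner_coe_orthogonal_eq_zero w v
  generalize (w : EuclideanSpace ℝ (Fin n)) = w at *
  generalize (v : EuclideanSpace ℝ (Fin n)) = v at *
  -- The first reflected plane nearly contains `w`.
  have ha : 99 / 100 * h ≤ ‖y - x‖ := by
    have := norm_sub_norm_le v (v - (y - x))
    rw [sub_sub_cancel, norm_sub_rev v, hvn] at this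
    linarith
  have hRw : ‖reflXY y x w - w‖ ≤ 2 / 99 * h := by
    have e1 := norm_reflXY_sub_self_mul_le y x w
    have e2 : inner ℝ (y - x) w = inner ℝ ((y - x) - v) w := by
      rw [inner_sub_left _ v, hvw, sub_zero]
    have e3 : |inner ℝ ((y - x) - v) w| ≤ h / 100 * h :=
      (abs_real_inner_le_norm _ _).trans (by rw [hwn]; gcongr)
    rw [e2] at e1
    nlinarith [norm_nonneg (reflXY y x w - w)]
  have hA : ‖(G.map (reflXY y x).toLinearMap).starProjection w - w‖ ≤ 6 / 100 * h := by
    rw [starProjection_map_reflXY]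
    have e : reflXY y x (G.starProjection (reflXY y x w)) - w =
        reflXY y x (G.starProjection (reflXY y x w - w)) +
          reflXY y x (G.starProjection w - w) + (reflXY y x w - w) := by
      simp only [map_sub]; abel
    rw [e]
    refine norm_add₃_le.trans ?_
    rw [LinearIsometryEquiv.norm_map, LinearIsometryEquiv.norm_map]
    have := Submodule.norm_starProjection_apply_le G (reflXY y x w - w)
    linarith
  -- The second reflected plane is nearly orthogonal to `w`, because `R_{v - w}` exchanges
  -- `w` and `v`.
  have hb : 99 / 100 * h ≤ ‖y' - x‖ := by
    have e1 := norm_sub_norm_le (v - w) ((v - w) - (y' - x))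
    have e2 : h ≤ ‖v - w‖ := by
      have := norm_sub_sq_real v w
      rw [hvw, hvn, hwn] at this
      nlinarith [norm_nonneg (v - w)]
    rw [sub_sub_cancel, norm_sub_rev (v - w)] at e1
    linarith
  have hRs : ‖reflXY y' x (w + v) - (w + v)‖ ≤ 4 / 99 * h := by
    have e1 := norm_reflXY_sub_self_mul_le y' x (w + v)
    have e2 : inner ℝ (y' - x) (w + v) = inner ℝ ((y' - x) - (v - w)) (w + v) := by
      rw [inner_sub_left _ (v - w), inner_sub_left v, inner_add_right v, inner_add_right w, hvw,
        hwv, real_inner_self_eq_norm_sq, real_inner_self_eq_norm_sq, hvn, hwn]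
      ring
    have e4 : ‖w + v‖ ≤ 2 * h := by
      have := norm_add_le w v
      linarith
    have e3 : |inner ℝ ((y' - x) - (v - w)) (w + v)| ≤ h / 100 * (2 * h) :=
      (abs_real_inner_le_norm _ _).trans (by gcongr)
    rw [e2] at e1
    nlinarith [norm_nonneg (reflXY y' x (w + v) - (w + v))]
  have hRb : reflXY y' x (y' - x) = -(y' - x) :=
    Submodule.reflection_orthogonalComplement_singleton_eq_neg _
  have hRv : ‖reflXY y' x w - v‖ ≤ 4 / 99 * h := by
    have e : (2 : ℝ) • (reflXY y' x w - v) = (reflXY y' x (w + v) - (w + v)) +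
        reflXY y' x ((y' - x) - (v - w)) + ((y' - x) - (v - w)) := by
      simp only [map_sub, map_add] at hRb ⊢
      rw [hRb, two_smul]
      abel
    have e1 : 2 * ‖reflXY y' x w - v‖ ≤ 4 / 99 * h + h / 100 + h / 100 := by
      calc 2 * ‖reflXY y' x w - v‖ = ‖(2 : ℝ) • (reflXY y' x w - v)‖ := by
            rw [norm_smul]; norm_num
        _ ≤ _ := by
            rw [e]
            refine norm_add₃_le.trans ?_
            rw [LinearIsometryEquiv.norm_map]
            gcongr
    linarith
  have hB : ‖(G'.map (reflXY y' x).toLinearMap).starProjection w‖ ≤ 6 / 100 * h := by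
    rw [starProjection_map_reflXY, LinearIsometryEquiv.norm_map]
    have e : G'.starProjection (reflXY y' x w) =
        G'.starProjection (reflXY y' x w - v) + G'.starProjection v := by
      rw [← map_add, sub_add_cancel]
    rw [e]
    refine (norm_add_le _ _).trans ?_
    have := Submodule.norm_starProjection_apply_le G' (reflXY y' x w - v)
    linarith
  have h3 := norm_starProjection_sub_le (G.map (reflXY y x).toLinearMap) T w
  have h4 := norm_starProjection_sub_le (G'.map (reflXY y' x).toLinearMap) T w
  rw [hwn] at h3 h4
  have e : w = -((G.map (reflXY y x).toLinearMap).starProjection w - w) +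
      ((G.map (reflXY y x).toLinearMap).starProjection w - T.starProjection w) +
      (-((G'.map (reflXY y' x).toLinearMap).starProjection w - T.starProjection w) +
      (G'.map (reflXY y' x).toLinearMap).starProjection w) := by abel
  have e2 : ‖w‖ ≤ _ := e ▸ norm_add₃_le
  have e3 := e2.trans (add_le_add_right (norm_add_le _ _) _)
  rw [norm_neg, norm_neg, hwn] at e3
  nlinarith

/-! ### Lipschitz graphs: vertical deviation and Hausdorff measure -/

/-- The vertical deviation of `z` from the graph `p + graph u`: the `Fᗮ`-component of `z - p` minus
the value of `u` below `z`. It vanishes exactly on the graph. -/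
noncomputable def verticalDev {n : ℕ} {F : Submodule ℝ (EuclideanSpace ℝ (Fin n))}
    (p : EuclideanSpace ℝ (Fin n)) (u : F → Fᗮ) (z : EuclideanSpace ℝ (Fin n)) : Fᗮ :=
  Fᗮ.orthogonalProjectionOnto (z - p) - u (F.orthogonalProjectionOnto (z - p))

section graph

variable {n : ℕ} {F : Submodule ℝ (EuclideanSpace ℝ (Fin n))}
  {p : EuclideanSpace ℝ (Fin n)} {u : F → Fᗮ} {β : ℝ≥0}

theorem coe_verticalDev (p : EuclideanSpace ℝ (Fin n)) (u : F → Fᗮ)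
    (z : EuclideanSpace ℝ (Fin n)) :
    (verticalDev p u z : EuclideanSpace ℝ (Fin n)) =
      z - graphPoint p u (F.orthogonalProjectionOnto (z - p)) := by
  have h := F.starProjection_add_starProjection_orthogonal (z - p)
  rw [Submodule.starProjection_apply, Submodule.starProjection_apply] at h
  rw [verticalDev, graphPoint, Submodule.coe_sub, ← sub_sub, ← sub_sub]
  nth_rw 3 [← h]
  abel

theorem orthogonalProjectionOnto_graphPoint_sub (p : EuclideanSpace ℝ (Fin n)) (u : F → Fᗮ)
    (ξ : F) : F.orthogonalProjectionOnto (graphPoint p u ξ - p) = ξ := by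
  rw [graphPoint, add_sub_cancel_left, map_add,
    Submodule.orthogonalProjectionOnto_mem_subspace_eq_self,
    Submodule.orthogonalProjectionOnto_eq_zero_iff.2 (u ξ).2, add_zero]

theorem mem_graphSet_iff_verticalDev_eq_zero {z : EuclideanSpace ℝ (Fin n)} :
    z ∈ graphSet p u ↔ verticalDev p u z = 0 := by
  rw [← Submodule.coe_eq_zero, coe_verticalDev, sub_eq_zero]
  constructor
  · rintro ⟨ξ, rfl⟩
    rw [orthogonalProjectionOnto_graphPoint_sub]
  · intro h
    exact ⟨_, h.symm⟩

theorem continuous_verticalDev (hu : Continuous u) : Continuous (verticalDev p u) := by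
  unfold verticalDev
  fun_prop

theorem continuous_graphPoint (hu : Continuous u) : Continuous (graphPoint p u) := by
  unfold graphPoint
  fun_prop

theorem isClosed_graphSet (hu : Continuous u) : IsClosed (graphSet p u) := by
  have : graphSet p u = verticalDev p u ⁻¹' {0} := by
    ext z
    exact mem_graphSet_iff_verticalDev_eq_zero
  rw [this]
  exact isClosed_singleton.preimage (continuous_verticalDev hu)

theorem norm_verticalDev_le (hu : LipschitzWith β u) (hβ : β ≤ 1) {x : EuclideanSpace ℝ (Fin n)}
    (hx : x ∈ graphSet p u) (z : EuclideanSpace ℝ (Fin n)) :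
    ‖verticalDev p u z‖ ≤ 2 * ‖z - x‖ := by
  have h : verticalDev p u z = Fᗮ.orthogonalProjectionOnto (z - x) -
      (u (F.orthogonalProjectionOnto (z - p)) - u (F.orthogonalProjectionOnto (x - p))) := by
    rw [← sub_zero (verticalDev p u z), ← mem_graphSet_iff_verticalDev_eq_zero.1 hx,
      verticalDev, verticalDev, ← sub_sub_sub_cancel_right z x p, map_sub _ (z - p) (x - p)]
    abel
  rw [h, two_mul]
  refine (norm_sub_le _ _).trans (add_le_add (Submodule.norm_orthogonalProjectionOnto_apply_le _ _)
    ((hu.norm_sub_le _ _).trans ?_))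
  rw [← map_sub, sub_sub_sub_cancel_right]
  calc (β : ℝ) * _ ≤ 1 * ‖z - x‖ := by
        gcongr
        · exact hβ
        · exact Submodule.norm_orthogonalProjectionOnto_apply_le _ _
    _ = _ := one_mul _

theorem graphPoint_sub_graphPoint (p : EuclideanSpace ℝ (Fin n)) (u : F → Fᗮ) (ξ η : F) :
    graphPoint p u ξ - graphPoint p u η = ((ξ - η : F) : EuclideanSpace ℝ (Fin n)) +
      ((u ξ - u η : Fᗮ) : EuclideanSpace ℝ (Fin n)) := by
  simp only [graphPoint, Submodule.coe_sub]
  abel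

theorem lipschitzWith_graphPoint (hu : LipschitzWith β u) (hβ : β ≤ 1) :
    LipschitzWith 2 (graphPoint p u) := by
  refine LipschitzWith.of_dist_le_mul fun ξ η => ?_
  rw [dist_eq_norm, dist_eq_norm, graphPoint_sub_graphPoint]
  refine (norm_add_le _ _).trans ?_
  have h1 : ‖u ξ - u η‖ ≤ 1 * ‖ξ - η‖ := (hu.norm_sub_le _ _).trans (by gcongr; exact hβ)
  simp only [Submodule.coe_norm, NNReal.coe_ofNat] at *
  linarith

end graph

theorem LipschitzWith.euclideanHausdorffMeasure_image_le {X Y : Type*} [MetricSpace X]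
    [MeasurableSpace X] [BorelSpace X] [MetricSpace Y] [MeasurableSpace Y] [BorelSpace Y]
    {C : ℝ≥0} {f : X → Y} (hf : LipschitzWith C f) (d : ℕ) (s : Set X) :
    (Measure.euclideanHausdorffMeasure d : Measure Y) (f '' s) ≤
      (C : ℝ≥0∞) ^ d * (Measure.euclideanHausdorffMeasure d : Measure X) s := by
  simp only [Measure.euclideanHausdorffMeasure_def, Measure.smul_apply, ENNReal.smul_def,
    smul_eq_mul]
  rw [mul_left_comm]
  gcongr
  simpa using hf.hausdorffMeasure_image_le (Nat.cast_nonneg d) s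

/-- The volume of the unit ball of `ℝᵐ`. -/
noncomputable def unitBallVolume (m : ℕ) : ℝ≥0∞ :=
  ENNReal.ofReal (Real.sqrt Real.pi ^ m / Real.Gamma (m / 2 + 1))

theorem unitBallVolume_pos (m : ℕ) : 0 < unitBallVolume m := by
  have := Real.Gamma_pos_of_pos (by positivity : (0 : ℝ) < m / 2 + 1)
  exact ENNReal.ofReal_pos.2 (by positivity)

section measure

variable {n m : ℕ} {F : Grass n m} {p : EuclideanSpace ℝ (Fin n)} {u : F.1 → F.1ᗮ} {β : ℝ≥0}

theorem euclideanHausdorffMeasure_grass (F : Grass n m) :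
    (Measure.euclideanHausdorffMeasure m : Measure F.1) = volume := by
  have h := InnerProductSpace.euclideanHausdorffMeasure_eq_volume (V := F.1)
  rwa [F.2] at h

/-- Lower Ahlfors regularity of a Lipschitz graph: its projection to the base plane does not
increase measure and maps a ball centred on the graph onto a comparable ball. -/
theorem le_measure_graphSet_inter_ball (hm : 1 ≤ m) (hu : LipschitzWith β u) (hβ : β ≤ 1) (ξ : F.1)
    (r : ℝ) :
    ENNReal.ofReal (r / 2) ^ m * unitBallVolume m ≤
      Measure.euclideanHausdorffMeasure m (graphSet p u ∩ Metric.ball (graphPoint p u ξ) r) := by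
  have : Nontrivial F.1 := Module.nontrivial_of_finrank_pos (R := ℝ) (by rw [F.2]; omega)
  have h1 : volume (Metric.ball ξ (r / 2)) = ENNReal.ofReal (r / 2) ^ m * unitBallVolume m := by
    rw [InnerProductSpace.volume_ball, F.2, unitBallVolume]
  have hL : LipschitzWith 1 fun z : EuclideanSpace ℝ (Fin n) =>
      F.1.orthogonalProjectionOnto (z - p) := by
    refine LipschitzWith.of_dist_le_mul fun x y => ?_
    rw [dist_eq_norm, ← map_sub, sub_sub_sub_cancel_right, dist_eq_norm, NNReal.coe_one, one_mul]
    exact Submodule.norm_orthogonalProjectionOnto_apply_le _ _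
  have h2 : Metric.ball ξ (r / 2) ⊆ (fun z : EuclideanSpace ℝ (Fin n) =>
      F.1.orthogonalProjectionOnto (z - p)) ''
        (graphSet p u ∩ Metric.ball (graphPoint p u ξ) r) := by
    intro η hη
    refine ⟨graphPoint p u η, ⟨⟨η, rfl⟩, ?_⟩, orthogonalProjectionOnto_graphPoint_sub p u η⟩
    have := (lipschitzWith_graphPoint (p := p) hu hβ).dist_le_mul η ξ
    rw [Metric.mem_ball] at hη ⊢
    simp only [NNReal.coe_ofNat] at this
    linarith
  rw [← h1, ← euclideanHausdorffMeasure_grass]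
  refine (measure_mono h2).trans ((hL.euclideanHausdorffMeasure_image_le m _).trans ?_)
  simp

/-- By Rademacher's theorem, a Lipschitz graph has tangent planes outside a null set. -/
theorem measure_image_not_differentiableAt (hu : LipschitzWith β u) (hβ : β ≤ 1) :
    Measure.euclideanHausdorffMeasure m (graphPoint p u '' {ξ | ¬ DifferentiableAt ℝ u ξ}) = 0 := by
  have h : (volume : Measure F.1) {ξ | ¬ DifferentiableAt ℝ u ξ} = 0 := hu.ae_differentiableAt
  refine le_antisymm (((lipschitzWith_graphPoint hu hβ).euclideanHausdorffMeasure_image_le m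
    _).trans ?_) bot_le
  rw [euclideanHausdorffMeasure_grass, h, mul_zero]

end measure

/-! ### Energy contributed at one scale -/

section shell

variable {n m : ℕ} {F : Grass n m} {p : EuclideanSpace ℝ (Fin n)} {u : F.1 → F.1ᗮ} {β : ℝ≥0}

/-- Seen from a point `y` near `z`, where `z` has vertical deviation `h` from the graph, there is a
ball of radius `h / 400` centred on the graph, at distance comparable to `h`, on which the angle in
the energy density is at least `1 / 4`, whatever the plane `H y` is. -/
theorem exists_quarter_le_angleMetric (hm : 1 ≤ m) (hu : LipschitzWith β u)
    (hβ : (β : ℝ) ≤ 1 / 200) {H : EuclideanSpace ℝ (Fin n) → Grass n m}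
    (hH : ∀ ξ, DifferentiableAt ℝ u ξ → H (graphPoint p u ξ) = tangentPlane F u ξ)
    {z y : EuclideanSpace ℝ (Fin n)} {h : ℝ} (hh : 0 < h) (hz : ‖verticalDev p u z‖ = h)
    (hy : ‖y - z‖ ≤ h / 400) :
    ∃ η : F.1, 99 / 100 * h ≤ ‖graphPoint p u η - z‖ ∧ ‖graphPoint p u η - z‖ ≤ 201 / 100 * h ∧
      ∀ ξ, DifferentiableAt ℝ u ξ → ‖graphPoint p u ξ - graphPoint p u η‖ ≤ h / 400 →
        1 / 4 ≤ angleMetric ((H (graphPoint p u ξ)).1.map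
          (reflXY (graphPoint p u ξ) y).toLinearMap) (H y).1 := by
  have : Nontrivial F.1 := Module.nontrivial_of_finrank_pos (R := ℝ) (by rw [F.2]; omega)
  obtain ⟨w, hw⟩ := exists_norm_eq F.1 hh.le
  set ξ₀ := F.1.orthogonalProjectionOnto (z - p)
  set v : F.1ᗮ := -verticalDev p u z with hv_def
  have hv : ‖v‖ = h := by rw [hv_def, norm_neg, hz]
  have hv0 : graphPoint p u ξ₀ - z = v := by
    rw [hv_def, Submodule.coe_neg, coe_verticalDev, neg_sub]
  have hvn : ‖(v : EuclideanSpace ℝ (Fin n))‖ = h := hv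
  have hwn : ‖(w : EuclideanSpace ℝ (Fin n))‖ = h := hw
  have he : ‖(graphPoint p u (ξ₀ - w) - z) - (v - w)‖ ≤ h / 200 := by
    have e : (graphPoint p u (ξ₀ - w) - z) - (v - w) =
        ((u (ξ₀ - w) - u ξ₀ : F.1ᗮ) : EuclideanSpace ℝ (Fin n)) := by
      rw [← hv0]
      simp only [graphPoint, Submodule.coe_sub]
      abel
    rw [e]
    change ‖u (ξ₀ - w) - u ξ₀‖ ≤ h / 200
    refine (hu.norm_sub_le _ _).trans ?_
    rw [sub_sub_cancel_left, norm_neg, hw]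
    nlinarith
  have hvw : h ≤ ‖(v : EuclideanSpace ℝ (Fin n)) - w‖ := by
    have e1 := norm_sub_sq_real (v : EuclideanSpace ℝ (Fin n)) w
    rw [real_inner_comm, inner_coe_orthogonal_eq_zero w v, hvn, hwn] at e1
    nlinarith [norm_nonneg ((v : EuclideanSpace ℝ (Fin n)) - w)]
  have hvw' : ‖(v : EuclideanSpace ℝ (Fin n)) - w‖ ≤ 2 * h :=
    (norm_sub_le _ _).trans (by rw [hvn, hwn]; linarith)
  have hL : ∀ ξ, ‖fderiv ℝ u ξ‖ ≤ 1 / 100 := fun ξ =>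
    (norm_fderiv_le_of_lipschitz ℝ hu).trans (hβ.trans (by norm_num))
  -- The angle cannot be small at points of both balls, so it is large throughout one of them.
  have key : ∀ ξ ξ', DifferentiableAt ℝ u ξ → DifferentiableAt ℝ u ξ' →
      ‖graphPoint p u ξ - graphPoint p u ξ₀‖ ≤ h / 400 →
      ‖graphPoint p u ξ' - graphPoint p u (ξ₀ - w)‖ ≤ h / 400 →
      1 / 4 ≤ angleMetric ((H (graphPoint p u ξ)).1.map
          (reflXY (graphPoint p u ξ) y).toLinearMap) (H y).1 ∨
      1 / 4 ≤ angleMetric ((H (graphPoint p u ξ')).1.map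
          (reflXY (graphPoint p u ξ') y).toLinearMap) (H y).1 := by
    intro ξ ξ' hd hd' hb hb'
    rw [hH ξ hd, hH ξ' hd']
    rw [norm_sub_rev] at hy
    refine quarter_le_angleMetric_or hh w v hw hv ?_ ?_
      ((norm_starProjection_range_graphMap_sub_le _ w).trans ?_)
      ((norm_starProjection_range_graphMap_le _ v).trans ?_)
    · have e : graphPoint p u ξ - y - v = (graphPoint p u ξ - graphPoint p u ξ₀) + (z - y) := by
        rw [← hv0]; abel
      rw [e]
      exact (norm_add_le _ _).trans (by linarith)
    · have e : graphPoint p u ξ' - y - (v - w) = (graphPoint p u ξ' - graphPoint p u (ξ₀ - w)) +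
          (z - y) + ((graphPoint p u (ξ₀ - w) - z) - (v - w)) := by
        abel
      rw [e]
      exact norm_add₃_le.trans (by linarith)
    · rw [hw]
      nlinarith [hL ξ]
    · rw [hv]
      nlinarith [hL ξ']
  by_cases hc : ∀ ξ, DifferentiableAt ℝ u ξ →
      ‖graphPoint p u ξ - graphPoint p u ξ₀‖ ≤ h / 400 →
        1 / 4 ≤ angleMetric ((H (graphPoint p u ξ)).1.map
          (reflXY (graphPoint p u ξ) y).toLinearMap) (H y).1
  · refine ⟨ξ₀, ?_, ?_, hc⟩ <;> rw [hv0, hvn] <;> linarith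
  · push Not at hc
    obtain ⟨ξ, hd, hb, hlt⟩ := hc
    refine ⟨ξ₀ - w, ?_, ?_, fun ξ' hd' hb' => (key ξ ξ' hd hd' hb hb').resolve_left hlt.not_ge⟩
    · have := norm_sub_norm_le ((v : EuclideanSpace ℝ (Fin n)) - w)
        ((v - w) - (graphPoint p u (ξ₀ - w) - z))
      rw [sub_sub_cancel, norm_sub_rev ((v : EuclideanSpace ℝ (Fin n)) - w)] at this
      linarith
    · have := norm_sub_norm_le (graphPoint p u (ξ₀ - w) - z) ((v : EuclideanSpace ℝ (Fin n)) - w)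
      linarith

/-- The part of the inner energy integral that comes from the graph, in a shell around `y` whose
radii are comparable to the vertical deviation `h`, is at least of order `h⁻ᵐ`. -/
theorem le_lintegral_moebiusDensity (hm : 1 ≤ m) {τ : ℝ} (hτ : -1 < τ) (hu : LipschitzWith β u)
    (hβ : (β : ℝ) ≤ 1 / 200) {H : EuclideanSpace ℝ (Fin n) → Grass n m}
    (hH : ∀ ξ, DifferentiableAt ℝ u ξ → H (graphPoint p u ξ) = tangentPlane F u ξ)
    {z y : EuclideanSpace ℝ (Fin n)} {h : ℝ} (hh : 0 < h) (hz : ‖verticalDev p u z‖ = h)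
    (hy : ‖y - z‖ ≤ h / 400) {A : Set (EuclideanSpace ℝ (Fin n))}
    (hA : graphSet p u ∩ Metric.ball z (3 * h) ⊆ A) :
    ENNReal.ofReal ((1 / 4) ^ ((1 + τ) * (m : ℝ)) / (3 * h) ^ (2 * m)) *
        (ENNReal.ofReal (h / 800) ^ m * unitBallVolume m) ≤
      ∫⁻ x in {x | ‖x - y‖ ∈ Ico (h / 2) (3 * h)} ∩ A, ENNReal.ofReal (moebiusDensity τ H x y)
        ∂(Measure.euclideanHausdorffMeasure m) := by
  have hβ1 : β ≤ 1 := by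
    rw [← NNReal.coe_le_coe]
    exact hβ.trans (by norm_num)
  obtain ⟨η, hη1, hη2, hη⟩ := exists_quarter_le_angleMetric hm hu hβ hH hh hz hy
  set B := graphSet p u ∩ Metric.ball (graphPoint p u η) (h / 400)
  have hdist : ∀ x ∈ B, ‖x - y‖ ∈ Ico (h / 2) (3 * h) ∧ ‖x - z‖ < 3 * h := by
    rintro x ⟨-, hx⟩
    rw [Metric.mem_ball, dist_eq_norm] at hx
    have e1 := norm_sub_le_norm_sub_add_norm_sub x (graphPoint p u η) z
    have e2 := norm_sub_le_norm_sub_add_norm_sub (graphPoint p u η) x z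
    have e3 := norm_sub_le_norm_sub_add_norm_sub x y z
    have e4 := norm_sub_le_norm_sub_add_norm_sub x z y
    rw [norm_sub_rev _ x] at e2
    rw [norm_sub_rev z y] at e4
    exact ⟨⟨by linarith, by linarith⟩, by linarith⟩
  have hBA : B ⊆ {x | ‖x - y‖ ∈ Ico (h / 2) (3 * h)} ∩ A := fun x hx =>
    ⟨(hdist x hx).1, hA ⟨hx.1, by
      rw [Metric.mem_ball, dist_eq_norm]
      exact (hdist x hx).2⟩⟩
  have hBm : MeasurableSet B :=
    (isClosed_graphSet hu.continuous).measurableSet.inter Metric.isOpen_ball.measurableSet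
  have hae : ∀ᵐ x ∂(Measure.euclideanHausdorffMeasure m : Measure (EuclideanSpace ℝ (Fin n))),
      x ∈ B → ENNReal.ofReal ((1 / 4) ^ ((1 + τ) * (m : ℝ)) / (3 * h) ^ (2 * m)) ≤
        ENNReal.ofReal (moebiusDensity τ H x y) := by
    filter_upwards [measure_eq_zero_iff_ae_notMem.1
      (measure_image_not_differentiableAt (p := p) hu hβ1)] with x hx hxB
    obtain ⟨ξ, rfl⟩ := hxB.1
    have hd : DifferentiableAt ℝ u ξ := by
      by_contra hd
      exact hx ⟨ξ, hd, rfl⟩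
    have hxb := hxB.2
    rw [Metric.mem_ball, dist_eq_norm] at hxb
    have hang := hη ξ hd hxb.le
    obtain ⟨h1, h2⟩ := (hdist _ hxB).1
    have h3 : 0 < ‖graphPoint p u ξ - y‖ := by linarith
    apply ENNReal.ofReal_le_ofReal
    unfold moebiusDensity
    gcongr
    have : 0 < 1 + τ := by linarith
    positivity
  calc _ ≤ ENNReal.ofReal ((1 / 4) ^ ((1 + τ) * (m : ℝ)) / (3 * h) ^ (2 * m)) *
          Measure.euclideanHausdorffMeasure m B := by
        gcongr
        refine le_trans (le_of_eq ?_) (le_measure_graphSet_inter_ball hm hu hβ1 η (h / 400))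
        rw [show h / 400 / 2 = h / 800 by ring]
    _ = ∫⁻ _ in B, ENNReal.ofReal ((1 / 4) ^ ((1 + τ) * (m : ℝ)) / (3 * h) ^ (2 * m))
          ∂(Measure.euclideanHausdorffMeasure m) := by rw [setLIntegral_const]
    _ ≤ ∫⁻ x in B, ENNReal.ofReal (moebiusDensity τ H x y)
          ∂(Measure.euclideanHausdorffMeasure m) :=
        lintegral_mono_ae ((ae_restrict_iff' hBm).2 hae)
    _ ≤ _ := lintegral_mono_set hBA

end shell

/-! ### Energy contributed by infinitely many scales -/

theorem pairwise_disjoint_shells {n : ℕ} {h : ℕ → ℝ} (hpos : ∀ l, 0 < h l)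
    (hh : ∀ l, h (l + 1) ≤ h l / 6) (y : EuclideanSpace ℝ (Fin n)) :
    Pairwise (Function.onFun Disjoint
      fun l => {x : EuclideanSpace ℝ (Fin n) | ‖x - y‖ ∈ Ico (h l / 2) (3 * h l)}) := by
  have hanti : Antitone h := antitone_nat_of_succ_le fun l => by linarith [hh l, hpos l]
  have key : ∀ k l, k < l → ∀ x : EuclideanSpace ℝ (Fin n),
      ‖x - y‖ ∈ Ico (h k / 2) (3 * h k) → ‖x - y‖ ∉ Ico (h l / 2) (3 * h l) := by
    intro k l hkl x hk hl
    have h1 := hanti (Nat.succ_le_of_lt hkl)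
    have h2 := hh k
    simp only [Nat.succ_eq_add_one] at h1
    linarith [hk.1, hl.2]
  intro k l hkl
  refine Set.disjoint_left.2 fun x hk hl => ?_
  rcases lt_or_gt_of_ne hkl with hlt | hlt
  · exact key k l hlt x hk hl
  · exact key l k hlt x hl hk

/-- Lower bounds for the inner integrals over countably many disjoint shells add up. No
measurability of the integrand `f` is needed, since the comparison function is measurable. -/
theorem tsum_le_lintegral_lintegral_of_shells {X : Type*} [MeasurableSpace X] (μ : Measure X)
    {A : Set X} {f : X → X → ℝ≥0∞} {B : ℕ → Set X} {s : X → ℕ → Set X} {c : ℕ → ℝ≥0∞}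
    (hB : ∀ l, MeasurableSet (B l)) (hBA : ∀ l, B l ⊆ A)
    (hs : ∀ y l, MeasurableSet (s y l)) (hd : ∀ y, Pairwise (Function.onFun Disjoint (s y)))
    (hc : ∀ l, ∀ y ∈ B l, c l ≤ ∫⁻ x in s y l ∩ A, f x y ∂μ) :
    ∑' l, c l * μ (B l) ≤ ∫⁻ y in A, ∫⁻ x in A, f x y ∂μ ∂μ := by
  have h1 : ∀ y, ∑' l, (B l).indicator (fun _ => c l) y ≤ ∫⁻ x in A, f x y ∂μ := by
    intro y
    calc ∑' l, (B l).indicator (fun _ => c l) y ≤ ∑' l, ∫⁻ x in s y l, f x y ∂(μ.restrict A) := by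
          refine ENNReal.tsum_le_tsum fun l => ?_
          rw [Measure.restrict_restrict (hs y l)]
          by_cases hy : y ∈ B l
          · rw [indicator_of_mem hy]
            exact hc l y hy
          · rw [indicator_of_notMem hy]
            exact bot_le
      _ = ∫⁻ x in ⋃ l, s y l, f x y ∂(μ.restrict A) := (lintegral_iUnion (hs y) (hd y) _).symm
      _ ≤ ∫⁻ x in A, f x y ∂μ := setLIntegral_le_lintegral _ _
  calc ∑' l, c l * μ (B l) = ∑' l, ∫⁻ y in A, (B l).indicator (fun _ => c l) y ∂μ := by
        refine tsum_congr fun l => ?_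
        rw [lintegral_indicator_const (hB l), Measure.restrict_apply (hB l),
          inter_eq_left.2 (hBA l)]
    _ = ∫⁻ y in A, ∑' l, (B l).indicator (fun _ => c l) y ∂μ :=
        (lintegral_tsum fun l => (measurable_const.indicator (hB l)).aemeasurable).symm
    _ ≤ _ := lintegral_mono h1

theorem exists_seq_le_div_six {P : ℝ → Prop} (hP : ∀ δ > 0, ∃ h, 0 < h ∧ h < δ ∧ P h) :
    ∃ h : ℕ → ℝ, ∀ l, 0 < h l ∧ h l < 1 ∧ P (h l) ∧ h (l + 1) ≤ h l / 6 := by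
  obtain ⟨h₀, h0pos, h0lt, h0P⟩ := hP 1 one_pos
  choose! g hg using hP
  let q : ℕ → ℝ := fun l => Nat.rec h₀ (fun _ h => g (h / 6)) l
  have hq : ∀ l, 0 < q l ∧ q l < 1 ∧ P (q l) := by
    intro l
    induction l with
    | zero => exact ⟨h0pos, h0lt, h0P⟩
    | succ l ih =>
      obtain ⟨a, b, c⟩ := hg (q l / 6) (by linarith [ih.1])
      exact ⟨a, by change g (q l / 6) < 1; linarith [ih.1, ih.2.1], c⟩
  exact ⟨q, fun l => ⟨(hq l).1, (hq l).2.1, (hq l).2.2,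
    (hg (q l / 6) (by linarith [(hq l).1])).2.1.le⟩⟩

section family

variable {n m : ℕ} {τ : ℝ} {β : ℝ≥0} {p : ℕ → EuclideanSpace ℝ (Fin n)} {F : ℕ → Grass n m}
  {u : ∀ i, (F i).1 → (F i).1ᗮ} {H : EuclideanSpace ℝ (Fin n) → Grass n m}

/-- The contribution of one scale `h` to the energy does not depend on `h`. -/
theorem scale_contribution_eq {a h : ℝ} (hh : 0 < h) (m : ℕ) (ω : ℝ≥0∞) :
    ENNReal.ofReal (a / (3 * h) ^ (2 * m)) * (ENNReal.ofReal (h / 800) ^ m * ω) *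
      (ENNReal.ofReal (h / 800) ^ m * ω) = ENNReal.ofReal (a / 2400 ^ (2 * m)) * ω ^ 2 := by
  have e : a / 2400 ^ (2 * m) = a / (3 * h) ^ (2 * m) * (h / 800) ^ (2 * m) := by
    rw [div_mul_eq_mul_div, mul_div_assoc, ← div_pow, div_eq_mul_inv a, ← inv_pow]
    congr 2
    field_simp
    norm_num
  rw [e, ENNReal.ofReal_mul' (by positivity), ENNReal.ofReal_pow (by positivity)]
  ring

/-- Consider those graphs `Γ_j` that are disjoint from all earlier ones. On a bounded region, the
points of the other graphs are either on `Γ_j` or at a definite vertical distance from it: otherwise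
infinitely many separated scales would each contribute the same amount to the energy. -/
theorem exists_gap_verticalDev (hm : 1 ≤ m) (hτ : -1 < τ) (hβ : (β : ℝ) ≤ 1 / 200)
    (huLip : ∀ i, LipschitzWith β (u i)) {S : Set (EuclideanSpace ℝ (Fin n))}
    (hS : ∀ i, graphSet (p i) (u i) ⊆ S) (hH : IsMockTangent p F u H)
    (hE : LocallyFiniteEnergy τ S H) (N : ℕ) :
    ∃ δ > 0, ∀ j, (∀ i < j, Disjoint (graphSet (p i) (u i)) (graphSet (p j) (u j))) →
      ∀ k, ∀ z ∈ graphSet (p k) (u k), ‖z‖ < N →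
        ‖verticalDev (p j) (u j) z‖ < δ → z ∈ graphSet (p j) (u j) := by
  by_contra! hcon
  have hβ1 : β ≤ 1 := by
    rw [← NNReal.coe_le_coe]
    exact hβ.trans (by norm_num)
  obtain ⟨h, hh⟩ := exists_seq_le_div_six (P := fun h => ∃ j,
      (∀ i < j, Disjoint (graphSet (p i) (u i)) (graphSet (p j) (u j))) ∧
      ∃ k, ∃ z ∈ graphSet (p k) (u k), ‖z‖ < N ∧ ‖verticalDev (p j) (u j) z‖ = h) (by
    intro δ hδ
    obtain ⟨j, hj, k, z, hzk, hzN, hzδ, hz⟩ := hcon δ hδ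
    refine ⟨_, norm_pos_iff.2 fun h0 => hz (mem_graphSet_iff_verticalDev_eq_zero.2 h0), hzδ,
      j, hj, k, z, hzk, hzN, rfl⟩)
  choose hpos hlt hP hdiv using hh
  choose j hj k z hzk hzN hz using hP
  -- All scales are at most `1`, so everything happens in the ball of radius `N + 3`.
  have hball : ∀ l x, ‖x - z l‖ < 3 * h l → x ∈ Metric.ball 0 ((N + 3 : ℕ) : ℝ) := by
    intro l x hx
    rw [mem_ball_zero_iff]
    have e : x = (x - z l) + z l := by abel
    have e1 := norm_add_le (x - z l) (z l)
    rw [← e] at e1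
    push_cast
    linarith [hzN l, hlt l]
  have hsum := tsum_le_lintegral_lintegral_of_shells (X := EuclideanSpace ℝ (Fin n))
    (Measure.euclideanHausdorffMeasure m) (A := S ∩ Metric.ball 0 ((N + 3 : ℕ) : ℝ))
    (f := fun x y => ENNReal.ofReal (moebiusDensity τ H x y))
    (B := fun l => graphSet (p (k l)) (u (k l)) ∩ Metric.ball (z l) (h l / 400))
    (s := fun y l => {x | ‖x - y‖ ∈ Ico (h l / 2) (3 * h l)})
    (c := fun l => ENNReal.ofReal ((1 / 4) ^ ((1 + τ) * (m : ℝ)) / (3 * h l) ^ (2 * m)) *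
        (ENNReal.ofReal (h l / 800) ^ m * unitBallVolume m))
    (fun l => (isClosed_graphSet (huLip _).continuous).measurableSet.inter
      Metric.isOpen_ball.measurableSet)
    (fun l x hx => ⟨hS _ hx.1, hball l x (by
      have := hx.2
      rw [Metric.mem_ball, dist_eq_norm] at this
      linarith [hpos l])⟩)
    (fun y l => measurableSet_Ico.preimage (by fun_prop))
    (fun y => pairwise_disjoint_shells hpos hdiv y)
    (fun l y hy => by
      have hy2 := hy.2
      rw [Metric.mem_ball, dist_eq_norm] at hy2
      refine le_lintegral_moebiusDensity hm hτ (huLip (j l)) hβ (fun ξ hξ => ?_) (hpos l) (hz l)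
        hy2.le ?_
      · exact hH (j l) ξ (fun i hi hmem => Set.disjoint_left.1 (hj l i hi) hmem ⟨ξ, rfl⟩) hξ
      · rintro x ⟨hx, hxb⟩
        rw [Metric.mem_ball, dist_eq_norm] at hxb
        exact ⟨hS _ hx, hball l x hxb⟩)
  refine (hsum.trans_lt (hE (N + 3))).ne (top_unique ?_)
  have hconst : ENNReal.ofReal ((1 / 4) ^ ((1 + τ) * (m : ℝ)) / 2400 ^ (2 * m)) *
      unitBallVolume m ^ 2 ≠ 0 :=
    mul_ne_zero (ENNReal.ofReal_pos.2 (by positivity)).ne'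
      (pow_ne_zero _ (unitBallVolume_pos m).ne')
  rw [← ENNReal.tsum_const_eq_top_of_ne_zero (α := ℕ) hconst]
  refine ENNReal.tsum_le_tsum fun l => ?_
  rw [← scale_contribution_eq (hpos l)]
  gcongr
  obtain ⟨ξ, hξ⟩ := hzk l
  refine le_trans (le_of_eq ?_) (hξ ▸ le_measure_graphSet_inter_ball hm (huLip (k l)) hβ1 ξ _)
  rw [show h l / 400 / 2 = h l / 800 by ring]

/-- A graph that meets `Γ_j`, where `Γ_j` is disjoint from all earlier graphs, lies in `Γ_j`: along
a segment in the base plane the vertical deviation from `Γ_j` cannot jump across the gap. -/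
theorem graphSet_subset_of_mem_inter (hm : 1 ≤ m) (hτ : -1 < τ) (hβ : (β : ℝ) ≤ 1 / 200)
    (huLip : ∀ i, LipschitzWith β (u i)) {S : Set (EuclideanSpace ℝ (Fin n))}
    (hS : ∀ i, graphSet (p i) (u i) ⊆ S) (hH : IsMockTangent p F u H)
    (hE : LocallyFiniteEnergy τ S H) {j : ℕ}
    (hj : ∀ i < j, Disjoint (graphSet (p i) (u i)) (graphSet (p j) (u j))) {k : ℕ}
    {z : EuclideanSpace ℝ (Fin n)} (hzk : z ∈ graphSet (p k) (u k))
    (hzj : z ∈ graphSet (p j) (u j)) : graphSet (p k) (u k) ⊆ graphSet (p j) (u j) := by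
  obtain ⟨ξ₀, rfl⟩ := hzk
  rintro _ ⟨ξ₁, rfl⟩
  by_contra hnot
  have hcont := continuous_graphPoint (p := p k) (huLip k).continuous
  have hcomp : IsCompact (graphPoint (p k) (u k) '' segment ℝ ξ₀ ξ₁) := by
    rw [← convexHull_pair]
    exact ((Set.toFinite {ξ₀, ξ₁}).isCompact_convexHull (𝕜 := ℝ)).image hcont
  obtain ⟨R, hR⟩ := hcomp.isBounded.exists_norm_le
  obtain ⟨N, hN⟩ := exists_nat_gt R
  obtain ⟨δ, hδ, hgap⟩ := exists_gap_verticalDev hm hτ hβ huLip hS hH hE N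
  have hdcont : Continuous fun ξ => ‖verticalDev (p j) (u j) (graphPoint (p k) (u k) ξ)‖ :=
    ((continuous_verticalDev (huLip j).continuous).comp hcont).norm
  have h0 : ‖verticalDev (p j) (u j) (graphPoint (p k) (u k) ξ₀)‖ = 0 := by
    rw [mem_graphSet_iff_verticalDev_eq_zero.1 hzj, norm_zero]
  have h1 : 0 < ‖verticalDev (p j) (u j) (graphPoint (p k) (u k) ξ₁)‖ :=
    norm_pos_iff.2 fun h => hnot (mem_graphSet_iff_verticalDev_eq_zero.2 h)
  set d := ‖verticalDev (p j) (u j) (graphPoint (p k) (u k) ξ₁)‖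
  have hmin : 0 < min d (δ / 2) := lt_min h1 (half_pos hδ)
  obtain ⟨ξ, hξ, hξd⟩ := (convex_segment (𝕜 := ℝ) ξ₀ ξ₁).isPreconnected.intermediate_value
    (left_mem_segment ℝ ξ₀ ξ₁) (right_mem_segment ℝ ξ₀ ξ₁) hdcont.continuousOn
    ⟨by rw [h0]; exact hmin.le, min_le_left d (δ / 2)⟩
  have hmem := hgap j hj k _ ⟨ξ, rfl⟩ ((hR _ ⟨ξ, hξ, rfl⟩).trans_lt hN)
    (by simp only at hξd; rw [hξd]; exact (min_le_right _ _).trans_lt (half_lt_self hδ))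
  rw [mem_graphSet_iff_verticalDev_eq_zero] at hmem
  simp only [hmem, norm_zero] at hξd
  exact hmin.ne hξd

/-- Every graph is contained in one that is disjoint from all graphs of smaller index. -/
theorem exists_graphSet_subset_disjoint (hm : 1 ≤ m) (hτ : -1 < τ) (hβ : (β : ℝ) ≤ 1 / 200)
    (huLip : ∀ i, LipschitzWith β (u i)) {S : Set (EuclideanSpace ℝ (Fin n))}
    (hS : ∀ i, graphSet (p i) (u i) ⊆ S) (hH : IsMockTangent p F u H)
    (hE : LocallyFiniteEnergy τ S H) (k : ℕ) :
    ∃ j, (∀ i < j, Disjoint (graphSet (p i) (u i)) (graphSet (p j) (u j))) ∧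
      graphSet (p k) (u k) ⊆ graphSet (p j) (u j) := by
  induction k using Nat.strong_induction_on with
  | _ k ih =>
    by_cases hk : ∀ i < k, Disjoint (graphSet (p i) (u i)) (graphSet (p k) (u k))
    · exact ⟨k, hk, Subset.rfl⟩
    · push Not at hk
      obtain ⟨i, hi, hik⟩ := hk
      obtain ⟨z, hzi, hzk⟩ := Set.not_disjoint_iff.1 hik
      obtain ⟨j, hj, hij⟩ := ih i hi
      exact ⟨j, hj, graphSet_subset_of_mem_inter hm hτ hβ huLip hS hH hE hj hzk (hij hzi)⟩

end family

/-! ### Local description of the closure -/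

theorem mainTheorem5 {n m : ℕ} (hm : 2 ≤ m) (hmn : m ≤ n) (τ : ℝ) (hτ : -1 < τ)
    (β : ℝ≥0) (hβ : (β : ℝ) < 1 / 6400)
    (p : ℕ → EuclideanSpace ℝ (Fin n)) (F : ℕ → Grass n m)
    (u : ∀ i, (F i).1 → (F i).1ᗮ)
    (hu0 : ∀ i, u i 0 = 0) (huLip : ∀ i, LipschitzWith β (u i))
    (S : Set (EuclideanSpace ℝ (Fin n))) (hS : S = closure (⋃ i, graphSet (p i) (u i)))
    (H : EuclideanSpace ℝ (Fin n) → Grass n m) (hH : IsMockTangent p F u H)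
    (hE : LocallyFiniteEnergy τ S H)
    (K : Set (EuclideanSpace ℝ (Fin n))) (hK : IsCompact K) (hKS : K ⊆ S) :
    ∃ ρ₃ : ℝ, 0 < ρ₃ ∧ ∀ q ∈ K, ∃ i : ℕ,
      S ∩ Metric.ball q (ρ₃ / 5) = graphSet (p i) (u i) ∩ Metric.ball q (ρ₃ / 5) := by
  have hm1 : 1 ≤ m := by omega
  have hβ' : (β : ℝ) ≤ 1 / 200 := hβ.le.trans (by norm_num)
  have hβ1 : β ≤ 1 := by
    rw [← NNReal.coe_le_coe]
    exact hβ'.trans (by norm_num)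
  have hSi : ∀ i, graphSet (p i) (u i) ⊆ S := fun i => by
    rw [hS]
    exact (subset_iUnion (fun i => graphSet (p i) (u i)) i).trans subset_closure
  obtain ⟨R, hR⟩ := hK.isBounded.exists_norm_le
  obtain ⟨N, hN⟩ := exists_nat_gt (R + 1)
  obtain ⟨δ, hδ, hgap⟩ := exists_gap_verticalDev hm1 hτ hβ' huLip hSi hH hE N
  -- Points of one ball are less than `2 r` apart, so their vertical deviations are below `4 r ≤ δ`.
  set r := min 1 (δ / 4)
  have hr : 0 < r := lt_min one_pos (by positivity)
  have hr1 : r ≤ 1 := min_le_left _ _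
  have hrδ : r ≤ δ / 4 := min_le_right _ _
  refine ⟨5 * r, by positivity, fun q hq => ?_⟩
  rw [mul_div_cancel_left₀ r (by norm_num : (5 : ℝ) ≠ 0)]
  obtain ⟨z, hz, hqz⟩ := Metric.mem_closure_iff.1 (hS ▸ hKS hq) r hr
  obtain ⟨k, hzk⟩ := mem_iUnion.1 hz
  obtain ⟨i, hi, hki⟩ := exists_graphSet_subset_disjoint hm1 hτ hβ' huLip hSi hH hE k
  refine ⟨i, Subset.antisymm ?_ (inter_subset_inter_left _ (hSi i))⟩
  refine fun x hx => ⟨?_, hx.2⟩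
  have hsub : (⋃ l, graphSet (p l) (u l)) ∩ Metric.ball q r ⊆ graphSet (p i) (u i) := by
    rintro y ⟨hy, hyq⟩
    obtain ⟨l, hyl⟩ := mem_iUnion.1 hy
    rw [Metric.mem_ball] at hyq
    have hyz : ‖y - z‖ < 2 * r := by
      rw [← dist_eq_norm]
      linarith [dist_triangle y q z]
    have hyN : ‖y‖ < N := by
      have e1 := norm_sub_norm_le y q
      rw [← dist_eq_norm] at e1
      linarith [hR q hq]
    refine hgap i hi l y hyl hyN ?_
    have := norm_verticalDev_le (huLip i) hβ1 (hki hzk) y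
    linarith
  have hx' : x ∈ closure ((⋃ l, graphSet (p l) (u l)) ∩ Metric.ball q r) := by
    rw [inter_comm]
    exact Metric.isOpen_ball.inter_closure ⟨hx.2, hS ▸ hx.1⟩
  exact closure_minimal hsub (isClosed_graphSet (huLip i).continuous) hx'
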